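/- **Setting.** Let $\mathcal F$ be a signature (symbols have a fixed arity or are variadic), $\mathcal V$ a set of variables, and $\mathcal R$ a term rewrite system, i.e. a set of rules $l\to r$ between terms over $\mathcal F,\mathcal V$ with $l\notin\mathcal V$ and $\mathrm{Var}(r)\subseteq\mathrm{Var}(l)$. The *defined symbols* $\mathcal D$ are the root symbols of left-hand sides; all other symbols are *constructors* ($\mathcal C$). Terms built from constructors and variables are *values*. $\mathcal R$ is a *constructor TRS* if all arguments of every left-hand side are values. The size $|t|$ is the number of occurrences of variables and function symbols in $t$. Write $s\to^{\mathrm i}_{\mathcal R}t$ (innermost step) if $s=C[l\sigma]$ and $t=C[r\sigma]$ for a rule $l\to r\in\mathcal R$, a context $C$ and a substitution $\sigma$ such that all proper subterms of $l\sigma$ are normal forms of $\mathcal R$. Let $\mathrm{dl}^{\mathrm i}(t)\in\mathbb N\cup\{\infty\}$ be the supremum of the lengths of innermost rewrite sequences starting in $t$. A *safe mapping* assigns to each symbol $f$ its set $\mathrm{safe}(f)$ of safe argument positions, such that all positions of a constructor are safe and no position of a variadic defined symbol is safe; the remaining positions, $\mathrm{nrm}(f)$, are called normal. A *precedence* $>$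 is a strict partial order on $\mathcal F$. Given a precedence and a safe mapping, define inductively $s=f(s_1,\dots,s_n)\sqsupset t$ if one of the following holds ($\sqsupseteq$ is the reflexive closure of $\sqsupset$): 1. $f\in\mathcal C$ and $s_i\sqsupseteq t$ for some $i$; 2. $s_i\sqsupseteq t$ for some $i\in\mathrm{nrm}(f)$; 3. $t=g(t_1,\dots,t_m)$, $f\in\mathcal D$, $f>g$, and $s\sqsupset t_i$ for all $i$. The *polynomial path order* POP$^*$ is defined inductively by $s=f(s_1,\dots,s_n)>_{\mathrm{pop}*}t$ if one of the following holds: 1. $s\sqsupset t$; 2. $s_i\geq_{\mathrm{pop}*}t$ for some $i$; 3. $t=g(t_1,\dots,t_m)$, $f\in\mathcal D$, $f>g$, and there is $i_0\in\mathrm{safe}(g)$ with $s>_{\mathrm{pop}*}t_{i_0}$ such that for every $i\neq i_0$ either $s\sqsupset t_i$, or $t_i$ is a proper subterm of $s$ and $i\in\mathrm{safe}(g)$; 4. $t=f(t_1,\dots,t_m)$, the multiset of the normal arguments of $s$ is greater than that of $t$ in the strict multiset extension of $>_{\mathrm{pop}*}$, and the multiset of the safe arguments of $s$ is greater than or equal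 to that of $t$ in the reflexive closure of this multiset extension. Here $\geq_{\mathrm{pop}*}$ is the reflexive closure of $>_{\mathrm{pop}*}$. A multiset $M$ is greater than $N$ in the strict multiset extension of a relation if $M=X\uplus Z$ and $N=Y\uplus Z$ with $X\ne\varnothing$ and every element of $Y$ is below some element of $X$. **Theorem.** Let $\mathcal R$ be a finite constructor TRS (not necessarily completely defined) such that $\mathcal R\subseteq{>_{\mathrm{pop}*}}$ for some precedence and some safe mapping. Then the induced normal innermost runtime complexity $$\mathrm{Rc}^{\mathrm n}_{\mathcal R}(m)=\sup\Big\{\mathrm{dl}^{\mathrm i}(t)\ \Big|\ t=f(t_1,\dots,t_n)\text{ with all } t_i\text{ values and }\sum_{i\in\mathrm{nrm}(f)}|t_i|\le m\Big\}$$ is finite and bounded by a polynomial in $m$. Consequently the innermost runtime complexity $$\mathrm{Rc}^{\mathrm i}_{\mathcal R}(m)=\sup\{\mathrm{dl}^{\mathrm i}(t)\mid t=f(t_1,\dots,t_n)\text{ with all } t_i\text{ values and } |t|\le m\}$$ is also finite and bounded by a polynomial in $m$. -/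

import Mathlib

namespace POPStar

universe u v

/-- A signature with symbols of fixed arity (`arity f = some n`) and
variadic symbols (`arity f = none`). -/
structure Signature where
  Symb : Type u
  arity : Symb → Option ℕ

/-- The symbol `f` may be applied to `n` arguments. -/
def Signature.Admits (S : Signature.{u}) (f : S.Symb) (n : ℕ) : Prop :=
  S.arity f = none ∨ S.arity f = some n

/-- Terms over the signature `S` and the variables `V`. -/
inductive Term (S : Signature.{u}) (V : Type v) : Type (max u v)
  | var (x : V) : Term S V
  | app (f : S.Symb) (n : ℕ) (h : S.Admits f n) (ts : Fin n → Term S V) : Term S V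

/-- One-hole contexts; the entry `ts i` at the position `i` of the hole is not used. -/
inductive Context (S : Signature.{u}) (V : Type v) : Type (max u v)
  | hole : Context S V
  | app (f : S.Symb) (n : ℕ) (h : S.Admits f n) (ts : Fin n → Term S V) (i : Fin n)
      (C : Context S V) : Context S V

variable {S : Signature.{u}} {V : Type v}

namespace Term

/-- The size: the number of occurrences of variables and function symbols. -/
def size : Term S V → ℕ
  | var _ => 1
  | app _ _ _ ts => 1 + ∑ i, (ts i).size

/-- The set of variables of a term. -/
def vars : Term S V → Set V
  | var x => {x}
  | app _ _ _ ts => ⋃ i, (ts i).vars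

/-- Application of a substitution. -/
def subst (σ : V → Term S V) : Term S V → Term S V
  | var x => σ x
  | app f n h ts => app f n h fun i => (ts i).subst σ

/-- `ProperSubterm s t`: the term `t` is a proper subterm of `s`. -/
inductive ProperSubterm : Term S V → Term S V → Prop
  | arg {f : S.Symb} {n : ℕ} {h : S.Admits f n} {ts : Fin n → Term S V} (i : Fin n) :
      ProperSubterm (app f n h ts) (ts i)
  | deep {f : S.Symb} {n : ℕ} {h : S.Admits f n} {ts : Fin n → Term S V} {t : Term S V}
      (i : Fin n) : ProperSubterm (ts i) t → ProperSubterm (app f n h ts) t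

end Term

/-- The term `C[s]`. -/
def Context.fill : Context S V → Term S V → Term S V
  | .hole, s => s
  | .app f n h ts i C, s => .app f n h (Function.update ts i (C.fill s))

/-- A rewrite rule `lhs → rhs`. -/
structure Rule (S : Signature.{u}) (V : Type v) where
  lhs : Term S V
  rhs : Term S V
  lhs_ne_var : ∀ x : V, lhs ≠ .var x
  vars_subset : rhs.vars ⊆ lhs.vars

/-- A term rewrite system: a set of rewrite rules. -/
abbrev TRS (S : Signature.{u}) (V : Type v) := Set (Rule S V)

namespace TRS

variable (R : TRS S V)

/-- The rewrite relation. -/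
def Step (s t : Term S V) : Prop :=
  ∃ ρ ∈ R, ∃ (C : Context S V) (σ : V → Term S V),
    s = C.fill (ρ.lhs.subst σ) ∧ t = C.fill (ρ.rhs.subst σ)

/-- Normal forms of the rewrite relation. -/
def IsNormalForm (s : Term S V) : Prop := ¬ ∃ t, R.Step s t

/-- The innermost rewrite relation. -/
def InnermostStep (s t : Term S V) : Prop :=
  ∃ ρ ∈ R, ∃ (C : Context S V) (σ : V → Term S V),
    s = C.fill (ρ.lhs.subst σ) ∧ t = C.fill (ρ.rhs.subst σ) ∧
    ∀ u, (ρ.lhs.subst σ).ProperSubterm u → R.IsNormalForm u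

/-- The defined symbols: the roots of left-hand sides. -/
def IsDefined (f : S.Symb) : Prop :=
  ∃ ρ ∈ R, ∃ (n : ℕ) (h : S.Admits f n) (ts : Fin n → Term S V), ρ.lhs = .app f n h ts

/-- All other symbols are constructors. -/
def IsConstructor (f : S.Symb) : Prop := ¬ R.IsDefined f

/-- Values: terms built from constructors and variables. -/
def IsValue : Term S V → Prop
  | .var _ => True
  | .app f _ _ ts => R.IsConstructor f ∧ ∀ i, IsValue (ts i)

/-- Constructor TRSs: the arguments of every left-hand side are values. -/
def IsConstructorTRS : Prop :=
  ∀ ρ ∈ R, ∀ (f : S.Symb) (n : ℕ) (h : S.Admits f n) (ts : Fin n → Term S V),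
    ρ.lhs = .app f n h ts → ∀ i, R.IsValue (ts i)

end TRS

/-- `StepsIn r n s t`: there is an `r`-sequence from `s` to `t` with exactly `n` steps. -/
inductive StepsIn {α : Type*} (r : α → α → Prop) : ℕ → α → α → Prop
  | zero (a : α) : StepsIn r 0 a a
  | succ {n : ℕ} {a b c : α} : r a b → StepsIn r n b c → StepsIn r (n + 1) a c

/-- The derivation length of `s`: the supremum in `ℕ∞` of the lengths of `r`-sequences
from `s` (which is a maximum as soon as it is finite). -/
noncomputable def derivationLength {α : Type*} (r : α → α → Prop) (s : α) : ℕ∞ :=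
  ⨆ (n : ℕ) (_ : ∃ t, StepsIn r n s t), (n : ℕ∞)

/-- A safe mapping for `R`. Argument positions are counted from `0`; only the positions
below the number of arguments of a term are ever looked at. All positions of constructors
are safe, and no position of a variadic defined symbol is safe. The positions that are not
safe are called normal. -/
structure SafeMapping (R : TRS S V) where
  safe : S.Symb → Set ℕ
  safe_of_constructor : ∀ f, R.IsConstructor f → safe f = Set.univ
  safe_of_variadic : ∀ f, R.IsDefined f → S.arity f = none → safe f = ∅

section Orders

open Classical in
/-- The multiset of the normal arguments of `f(s₁, …, sₙ)`. -/
noncomputable def SafeMapping.normalArgs {R : TRS S V} (μ : SafeMapping R) (f : S.Symb) {n : ℕ}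
    (s : Fin n → Term S V) : Multiset (Term S V) :=
  (Finset.univ.filter fun i : Fin n => (i : ℕ) ∉ μ.safe f).val.map s

open Classical in
/-- The multiset of the safe arguments of `f(s₁, …, sₙ)`. -/
noncomputable def SafeMapping.safeArgs {R : TRS S V} (μ : SafeMapping R) (f : S.Symb) {n : ℕ}
    (s : Fin n → Term S V) : Multiset (Term S V) :=
  (Finset.univ.filter fun i : Fin n => (i : ℕ) ∈ μ.safe f).val.map s

/-- The (strict) multiset extension of `r`, where `r a b` reads `a > b`. -/
def MulGt {α : Type*} (r : α → α → Prop) (M N : Multiset α) : Prop :=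
  ∃ X Y Z : Multiset α, X ≠ 0 ∧ M = X + Z ∧ N = Y + Z ∧ ∀ y ∈ Y, ∃ x ∈ X, r x y

/-- The reflexive closure of the multiset extension of `r`. -/
def MulGe {α : Type*} (r : α → α → Prop) (M N : Multiset α) : Prop :=
  M = N ∨ MulGt r M N

variable (R : TRS S V) (gt : S.Symb → S.Symb → Prop) (μ : SafeMapping R)

/-- The auxiliary order `s ⊐ t` of the polynomial path order, for the precedence `gt`
(`gt f g` reads `f > g`) and the safe mapping `μ`. The clause `sᵢ ⊒ t` is split into
`sᵢ = t` and `sᵢ ⊐ t`. -/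
inductive GtSq : Term S V → Term S V → Prop
  | arg_eq {f : S.Symb} {n : ℕ} {h : S.Admits f n} {s : Fin n → Term S V} (i : Fin n) :
      (R.IsConstructor f ∨ (i : ℕ) ∉ μ.safe f) → GtSq (.app f n h s) (s i)
  | arg_gt {f : S.Symb} {n : ℕ} {h : S.Admits f n} {s : Fin n → Term S V} {t : Term S V}
      (i : Fin n) :
      (R.IsConstructor f ∨ (i : ℕ) ∉ μ.safe f) → GtSq (s i) t → GtSq (.app f n h s) t
  | drop {f g : S.Symb} {n m : ℕ} {h : S.Admits f n} {k : S.Admits g m}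
      {s : Fin n → Term S V} {t : Fin m → Term S V} :
      R.IsDefined f → gt f g → (∀ i, GtSq (.app f n h s) (t i)) →
      GtSq (.app f n h s) (.app g m k t)

/-- The polynomial path order POP*. In the last clause `r` is an arbitrary subrelation of
the order; as multiset extensions are monotone, this amounts to using the multiset
extensions of the order itself, see `gtPop_iff`. -/
inductive GtPop : Term S V → Term S V → Prop
  | of_sq {s t : Term S V} : GtSq R gt μ s t → GtPop s t
  | arg_eq {f : S.Symb} {n : ℕ} {h : S.Admits f n} {s : Fin n → Term S V} (i : Fin n) :
      GtPop (.app f n h s) (s i)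
  | arg_gt {f : S.Symb} {n : ℕ} {h : S.Admits f n} {s : Fin n → Term S V} {t : Term S V}
      (i : Fin n) : GtPop (s i) t → GtPop (.app f n h s) t
  | drop {f g : S.Symb} {n m : ℕ} {h : S.Admits f n} {k : S.Admits g m}
      {s : Fin n → Term S V} {t : Fin m → Term S V} (i₀ : Fin m) :
      R.IsDefined f → gt f g → (i₀ : ℕ) ∈ μ.safe g → GtPop (.app f n h s) (t i₀) →
      (∀ i, i ≠ i₀ → GtSq R gt μ (.app f n h s) (t i) ∨
        ((Term.app f n h s).ProperSubterm (t i) ∧ (i : ℕ) ∈ μ.safe g)) →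
      GtPop (.app f n h s) (.app g m k t)
  | same {f : S.Symb} {n m : ℕ} {h : S.Admits f n} {k : S.Admits f m}
      {s : Fin n → Term S V} {t : Fin m → Term S V} (r : Term S V → Term S V → Prop) :
      (∀ a b, r a b → GtPop a b) →
      MulGt r (μ.normalArgs f s) (μ.normalArgs f t) →
      MulGe r (μ.safeArgs f s) (μ.safeArgs f t) →
      GtPop (.app f n h s) (.app f m k t)

theorem MulGt.mono {α : Type*} {r q : α → α → Prop} (hrq : ∀ a b, r a b → q a b)
    {M N : Multiset α} (h : MulGt r M N) : MulGt q M N := by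
  obtain ⟨X, Y, Z, hX, hM, hN, hY⟩ := h
  refine ⟨X, Y, Z, hX, hM, hN, fun y hy => ?_⟩
  obtain ⟨x, hx, hxy⟩ := hY y hy
  exact ⟨x, hx, hrq _ _ hxy⟩

/-- The recursive characterisation of the polynomial path order. -/
theorem gtPop_iff (f : S.Symb) (n : ℕ) (h : S.Admits f n) (s : Fin n → Term S V)
    (t : Term S V) :
    GtPop R gt μ (.app f n h s) t ↔
      GtSq R gt μ (.app f n h s) t ∨
      (∃ i, s i = t ∨ GtPop R gt μ (s i) t) ∨
      (∃ (g : S.Symb) (m : ℕ) (k : S.Admits g m) (ts : Fin m → Term S V),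
        t = .app g m k ts ∧ R.IsDefined f ∧ gt f g ∧
        ∃ i₀ : Fin m, (i₀ : ℕ) ∈ μ.safe g ∧ GtPop R gt μ (.app f n h s) (ts i₀) ∧
          ∀ i, i ≠ i₀ → GtSq R gt μ (.app f n h s) (ts i) ∨
            ((Term.app f n h s).ProperSubterm (ts i) ∧ (i : ℕ) ∈ μ.safe g)) ∨
      (∃ (m : ℕ) (k : S.Admits f m) (ts : Fin m → Term S V),
        t = .app f m k ts ∧
        MulGt (GtPop R gt μ) (μ.normalArgs f s) (μ.normalArgs f ts) ∧
        MulGe (GtPop R gt μ) (μ.safeArgs f s) (μ.safeArgs f ts)) := by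
  constructor
  · intro H
    cases H with
    | of_sq H => exact .inl H
    | arg_eq i => exact .inr (.inl ⟨i, .inl rfl⟩)
    | arg_gt i H => exact .inr (.inl ⟨i, .inr H⟩)
    | drop i₀ hf hg hi H H2 =>
      exact .inr (.inr (.inl ⟨_, _, _, _, rfl, hf, hg, i₀, hi, H, H2⟩))
    | same r hr h1 h2 =>
      exact .inr (.inr (.inr ⟨_, _, _, rfl, h1.mono hr, h2.imp id (MulGt.mono hr)⟩))
  · rintro (H | ⟨i, rfl | H⟩ | ⟨g, m, k, ts, rfl, hf, hg, i₀, hi, H, H2⟩ |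
      ⟨m, k, ts, rfl, h1, h2⟩)
    · exact .of_sq H
    · exact .arg_eq i
    · exact .arg_gt i H
    · exact .drop i₀ hf hg hi H H2
    · exact .same _ (fun _ _ H => H) h1 h2

/-- `R` is compatible with the polynomial path order induced by `gt` and `μ`. -/
def IsCompatiblePop : Prop := ∀ ρ ∈ R, GtPop R gt μ ρ.lhs ρ.rhs

end Orders

section Complexity

variable (R : TRS S V)

/-- The innermost runtime complexity: the supremum of the innermost derivation lengths of
the constructor-based terms of size at most `m`. -/
noncomputable def runtimeComplexity (m : ℕ) : ℕ∞ :=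
  ⨆ (f : S.Symb) (n : ℕ) (h : S.Admits f n) (ts : Fin n → Term S V)
    (_ : ∀ i, R.IsValue (ts i)) (_ : (Term.app f n h ts).size ≤ m),
    derivationLength R.InnermostStep (.app f n h ts)

/-- The normal runtime complexity: the supremum of the innermost derivation lengths of the
constructor-based terms whose normal arguments have sizes that sum up to at most `m`. -/
noncomputable def normalRuntimeComplexity (μ : SafeMapping R) (m : ℕ) : ℕ∞ :=
  ⨆ (f : S.Symb) (n : ℕ) (h : S.Admits f n) (ts : Fin n → Term S V)
    (_ : ∀ i, R.IsValue (ts i)) (_ : ((μ.normalArgs f ts).map Term.size).sum ≤ m),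
    derivationLength R.InnermostStep (.app f n h ts)

/-- A function with values in `ℕ∞` is finite everywhere and bounded by a polynomial. -/
def PolynomiallyBounded (F : ℕ → ℕ∞) : Prop :=
  ∃ p : Polynomial ℕ, ∀ m : ℕ, F m ≤ ((p.eval m : ℕ) : ℕ∞)

end Complexity

end POPStar

/-!
Innermost derivations are measured against the *depth* of terms rather than their size: a safe
argument may be duplicated below a constructor again and again, so sizes of normal forms can grow
exponentially, but every rewrite step increases the depth only by a constant
(`exists_depth_le_of_steps`).

The heart of the proof is that for every symbol `f` there is a polynomial `p` such that every
innermost derivation from `f(u₁, …, uₖ)`, all `uᵢ` being normal forms, has length at most `p M`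
as soon as the normal arguments have depth at most `M` (`CostBounded`); the safe arguments do
not matter. This is proved by induction on the precedence, which is well-founded on the finitely
many defined symbols. An innermost derivation first evaluates the arguments, then
contracts the root (`StepsIn.app_decompose`), so it remains to bound the derivations from `rσ`
for the rules `l → r` with root `f`:

* On values both orders are contained in the subterm relation, so what lies below an argument of
  `l` is instantiated to a normal form.
* If `l ⊐ t`, then `t` is a combination of normal arguments and of symbols below `f`; by
  composition of polynomials both the cost and the depth of the results of `tσ` are polynomial in
  `M` (`GtSq.exists_bound`).
* If `l >pop* t`, then the same holds for `tσ`, except for at most one recursive call of `f`. This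
  call is always nested in safe positions, hence its result does not influence the cost of the
  surrounding calls, and the multiset of the depths of its normal arguments is smaller than that
  of `lσ` in the Dershowitz–Manna order (`GtPop.exists_bound`).

As the arity of `f` in left-hand sides is bounded by some `K`, only `(M + 2) ^ K` multisets of depths
come into question, which bounds the number of nested recursive calls (`exists_rank`).
-/

namespace POPStar

universe u v

variable {S : Signature.{u}} {V : Type v}

/-! ### Polynomials with natural coefficients -/

theorem exists_uniform_polynomial {α : Type*} {s : Set α} (hs : s.Finite)
    {P : α → Polynomial ℕ → Prop}
    (hmono : ∀ a p q, (∀ m : ℕ, p.eval m ≤ q.eval m) → P a p → P a q)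
    (h : ∀ a ∈ s, ∃ p, P a p) : ∃ p, ∀ a ∈ s, P a p := by
  choose! p hp using h
  refine ⟨∑ a ∈ hs.toFinset, p a, fun a ha => hmono a (p a) _ (fun m => ?_) (hp a ha)⟩
  rw [Polynomial.eval_finsetSum]
  exact Finset.single_le_sum (f := fun a => (p a).eval m) (fun _ _ => Nat.zero_le _)
    (hs.mem_toFinset.2 ha)

theorem exists_uniform_nat {α : Type*} {s : Set α} (hs : s.Finite) (g : α → ℕ) :
    ∃ K, ∀ a ∈ s, g a ≤ K :=
  ⟨hs.toFinset.sup g, fun _ ha => Finset.le_sup (f := g) (hs.mem_toFinset.2 ha)⟩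

/-! ### Ranks of bounded multisets in the Dershowitz–Manna order -/

/-- The multisets with at most `K` elements, all of them at most `M`. -/
def boundedMultisets (M : ℕ) : ℕ → Finset (Multiset ℕ)
  | 0 => {0}
  | K + 1 => boundedMultisets M K ∪
      Finset.image₂ (fun a B => a ::ₘ B) (Finset.range (M + 1)) (boundedMultisets M K)

theorem card_boundedMultisets_le (M K : ℕ) : (boundedMultisets M K).card ≤ (M + 2) ^ K := by
  induction K with
  | zero => simp [boundedMultisets]
  | succ K ih =>
    rw [boundedMultisets]
    refine (Finset.card_union_le _ _).trans ?_
    have h := Finset.card_image₂_le (fun (a : ℕ) (B : Multiset ℕ) => a ::ₘ B)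
      (Finset.range (M + 1)) (boundedMultisets M K)
    rw [Finset.card_range] at h
    calc _ ≤ (boundedMultisets M K).card + (M + 1) * (boundedMultisets M K).card := by gcongr
      _ = (boundedMultisets M K).card * (M + 2) := by ring
      _ ≤ (M + 2) ^ K * (M + 2) := by gcongr
      _ = (M + 2) ^ (K + 1) := by ring

theorem mem_boundedMultisets {M K : ℕ} {B : Multiset ℕ} (hc : B.card ≤ K)
    (hB : ∀ b ∈ B, b ≤ M) : B ∈ boundedMultisets M K := by
  induction K generalizing B with
  | zero => simp_all [boundedMultisets]
  | succ K ih =>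
    rw [boundedMultisets, Finset.mem_union]
    induction B using Multiset.induction_on with
    | empty => exact .inl (ih (by simp) (by simp))
    | cons a B _ =>
      refine .inr (Finset.mem_image₂.2 ⟨a, ?_, B, ih ?_ ?_, rfl⟩)
      · exact Finset.mem_range.2 (Nat.lt_succ_of_le (hB a (by simp)))
      · simpa using hc
      · exact fun b hb => hB b (by simp [hb])

/-- The rank of `A` is the number of bounded multisets below `A`. -/
theorem exists_rank (M K : ℕ) : ∃ rk : Multiset ℕ → ℕ, (∀ A, rk A ≤ (M + 2) ^ K) ∧
    ∀ A B, B.card ≤ K → (∀ b ∈ B, b ≤ M) → B.IsDershowitzMannaLT A → rk B < rk A := by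
  classical
  refine ⟨fun A => ((boundedMultisets M K).filter fun B => B.IsDershowitzMannaLT A).card,
    fun A => (Finset.card_filter_le _ _).trans (card_boundedMultisets_le M K),
    fun A B hc hB h => Finset.card_lt_card ?_⟩
  refine Finset.ssubset_iff_subset_ne.2 ⟨fun C hC => ?_, fun heq => ?_⟩
  · simp only [Finset.mem_filter] at hC ⊢
    exact ⟨hC.1, hC.2.trans h⟩
  · have hmem : B ∈ (boundedMultisets M K).filter fun C => C.IsDershowitzMannaLT A :=
      Finset.mem_filter.2 ⟨mem_boundedMultisets hc hB, h⟩
    rw [← heq] at hmem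
    exact Multiset.wellFounded_isDershowitzMannaLT.irrefl.irrefl B (Finset.mem_filter.1 hmem).2

/-! ### Depth and subterms -/

namespace Term

/-- The depth of a term; variables and constants have depth one. -/
def depth : Term S V → ℕ
  | var _ => 1
  | app _ _ _ ts => 1 + Finset.univ.sup fun i => (ts i).depth

theorem depth_arg_lt {f : S.Symb} {n : ℕ} (h : S.Admits f n) (ts : Fin n → Term S V)
    (i : Fin n) : (ts i).depth < (app f n h ts).depth := by
  have := Finset.le_sup (f := fun i => (ts i).depth) (Finset.mem_univ i)
  simp only [depth] at this ⊢
  omega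

theorem depth_app_le {f : S.Symb} {n : ℕ} (h : S.Admits f n) {ts : Fin n → Term S V} {D : ℕ}
    (hD : ∀ i, (ts i).depth ≤ D) : (app f n h ts).depth ≤ 1 + D := by
  have := Finset.sup_le (s := Finset.univ) (f := fun i => (ts i).depth) fun i _ => hD i
  simp only [depth]
  omega

theorem depth_le_size (t : Term S V) : t.depth ≤ t.size := by
  induction t with
  | var x => simp [depth, size]
  | app f n h ts ih =>
    refine depth_app_le h fun i => (ih i).trans ?_
    exact Finset.single_le_sum (f := fun i => (ts i).size) (fun _ _ => Nat.zero_le _)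
      (Finset.mem_univ i)

theorem depth_subst_le {σ : V → Term S V} {D : ℕ} (t : Term S V)
    (hD : ∀ x ∈ t.vars, (σ x).depth ≤ D) : (t.subst σ).depth ≤ t.depth + D := by
  induction t with
  | var x =>
    have := hD x rfl
    simp only [subst, depth]
    omega
  | app f n h ts ih =>
    rw [subst]
    have hi : ∀ i, ((ts i).subst σ).depth ≤ ((app f n h ts).depth - 1) + D := fun i => by
      have h1 := ih i fun x hx => hD x (Set.mem_iUnion.2 ⟨i, hx⟩)
      have h2 := depth_arg_lt h ts i
      omega
    have h1 := depth_app_le h hi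
    have h2 : 1 ≤ (app f n h ts).depth := by simp [depth]
    omega

theorem depth_le_depth_subst {σ : V → Term S V} {t : Term S V} {x : V} (hx : x ∈ t.vars) :
    (σ x).depth ≤ (t.subst σ).depth := by
  induction t with
  | var y =>
    obtain rfl : x = y := hx
    exact le_rfl
  | app f n h ts ih =>
    obtain ⟨i, hi⟩ := Set.mem_iUnion.1 hx
    exact (ih i hi).trans (depth_arg_lt h (fun i => (ts i).subst σ) i).le

theorem ProperSubterm.depth_lt {s t : Term S V} (hst : s.ProperSubterm t) :
    t.depth < s.depth := by
  induction hst with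
  | arg i => exact depth_arg_lt _ _ i
  | deep i _ ih => exact ih.trans (depth_arg_lt _ _ i)

theorem ProperSubterm.subst {s t : Term S V} (σ : V → Term S V) (hst : s.ProperSubterm t) :
    (s.subst σ).ProperSubterm (t.subst σ) := by
  induction hst with
  | @arg f n h ts i => exact ProperSubterm.arg (h := h) (ts := fun i => (ts i).subst σ) i
  | @deep f n h ts t i _ ih =>
    exact ProperSubterm.deep (h := h) (ts := fun i => (ts i).subst σ) i ih

end Term

theorem Context.depth_fill_le {L : ℕ} (C : Context S V) {s t : Term S V}
    (h : t.depth ≤ s.depth + L) : (C.fill t).depth ≤ (C.fill s).depth + L := by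
  induction C with
  | hole => exact h
  | app f n k ts i C ih =>
    simp only [Context.fill]
    have hj : ∀ j, (Function.update ts i (C.fill t) j).depth ≤
        ((Term.app f n k (Function.update ts i (C.fill s))).depth - 1) + L := fun j => by
      have h2 := Term.depth_arg_lt k (Function.update ts i (C.fill s)) j
      by_cases hji : j = i
      · subst hji
        simp only [Function.update_self] at h2 ⊢
        omega
      · simp only [Function.update_of_ne hji] at h2 ⊢
        omega
    have h1 := Term.depth_app_le k hj
    have h2 : 1 ≤ (Term.app f n k (Function.update ts i (C.fill s))).depth := by
      simp [Term.depth]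
    omega

/-! ### Innermost derivations -/

section Derivations

variable {R : TRS S V}

theorem TRS.IsNormalForm.steps_eq_zero {N : ℕ} {s t : Term S V} (hs : R.IsNormalForm s)
    (h : StepsIn R.InnermostStep N s t) : N = 0 := by
  cases h with
  | zero => rfl
  | succ h _ =>
    obtain ⟨ρ, hρ, C, σ, h1, h2, -⟩ := h
    exact absurd ⟨_, ρ, hρ, C, σ, h1, h2⟩ hs

/-- An innermost step takes place in an argument or at the root; in the latter case all
arguments are normal forms. -/
theorem TRS.InnermostStep.app_cases {f : S.Symb} {n : ℕ} {h : S.Admits f n}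
    {ts : Fin n → Term S V} {b : Term S V} (hb : R.InnermostStep (.app f n h ts) b) :
    (∀ i, R.IsNormalForm (ts i)) ∨
      ∃ i v, R.InnermostStep (ts i) v ∧ b = .app f n h (Function.update ts i v) := by
  obtain ⟨ρ, hρ, C, σ, h1, rfl, hnf⟩ := hb
  cases C with
  | hole =>
    simp only [Context.fill] at h1
    rw [← h1] at hnf
    exact .inl fun i => hnf _ (.arg i)
  | app f' n' h' ts' i C =>
    simp only [Context.fill] at h1
    injection h1 with hf hn hts
    subst hf hn
    obtain rfl := eq_of_heq hts
    refine .inr ⟨i, C.fill (ρ.rhs.subst σ), ⟨ρ, hρ, C, σ, ?_, rfl, hnf⟩, ?_⟩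
    · simp
    · simp [Context.fill]

/-- An innermost derivation from `f(t₁, …, tₙ)` evaluates the arguments to some `uᵢ`, and
continues with a step at the root only if all `uᵢ` are normal forms. -/
theorem StepsIn.app_decompose {f : S.Symb} {n : ℕ} {h : S.Admits f n}
    {ts : Fin n → Term S V} {N : ℕ} {u : Term S V}
    (H : StepsIn R.InnermostStep N (.app f n h ts) u) :
    ∃ (Ns : Fin n → ℕ) (us : Fin n → Term S V) (N' : ℕ),
      (∀ i, StepsIn R.InnermostStep (Ns i) (ts i) (us i)) ∧ N = ∑ i, Ns i + N' ∧
      (N' = 0 ∨ (∀ i, R.IsNormalForm (us i)) ∧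
        StepsIn R.InnermostStep N' (.app f n h us) u) := by
  induction N generalizing ts with
  | zero => exact ⟨fun _ => 0, ts, 0, fun i => .zero _, by simp, .inl rfl⟩
  | succ N ih =>
    cases H with
    | succ h1 h2 =>
      rcases h1.app_cases with hnf | ⟨i, v, hv, rfl⟩
      · exact ⟨fun _ => 0, ts, N + 1, fun i => .zero _, by simp, .inr ⟨hnf, .succ h1 h2⟩⟩
      · obtain ⟨Ns, us, N', hs, hN, hr⟩ := ih h2
        refine ⟨fun j => Ns j + if j = i then 1 else 0, us, N', fun j => ?_, ?_, hr⟩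
        · have := hs j
          by_cases hj : j = i
          · subst hj
            rw [Function.update_self] at this
            simpa using StepsIn.succ hv this
          · rw [Function.update_of_ne hj] at this
            simpa [hj] using this
        · rw [Finset.sum_add_distrib]
          simp only [Finset.sum_ite_eq', Finset.mem_univ, if_true]
          omega

/-- If the arguments are normal forms, a derivation is empty or starts with a step at the
root. -/
theorem StepsIn.app_root {f : S.Symb} {n : ℕ} {h : S.Admits f n}
    {ts : Fin n → Term S V} (hts : ∀ i, R.IsNormalForm (ts i)) {N : ℕ} {u : Term S V}
    (H : StepsIn R.InnermostStep N (.app f n h ts) u) :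
    N = 0 ∨ ∃ ρ ∈ R, ∃ (σ : V → Term S V) (N' : ℕ), ρ.lhs.subst σ = .app f n h ts ∧
      (∀ w, (ρ.lhs.subst σ).ProperSubterm w → R.IsNormalForm w) ∧
      N = N' + 1 ∧ StepsIn R.InnermostStep N' (ρ.rhs.subst σ) u := by
  cases H with
  | zero => exact .inl rfl
  | succ h1 h2 =>
    refine .inr ?_
    obtain ⟨ρ, hρ, C, σ, h1, rfl, hnf⟩ := h1
    cases C with
    | hole => exact ⟨ρ, hρ, σ, _, h1.symm, hnf, rfl, h2⟩
    | app f' n' h' ts' i C =>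
      simp only [Context.fill] at h1
      injection h1 with hf hn hts'
      subst hf hn
      obtain rfl := eq_of_heq hts'
      refine absurd ⟨_, ρ, hρ, C, σ, ?_, rfl⟩ (hts i)
      simp

theorem exists_depth_le_of_steps (hfin : R.Finite) : ∃ L, ∀ (N : ℕ) (s t : Term S V),
    StepsIn R.InnermostStep N s t → t.depth ≤ s.depth + L * N := by
  obtain ⟨L, hL⟩ := exists_uniform_nat hfin fun ρ => ρ.rhs.depth
  refine ⟨L, fun N s t h => ?_⟩
  induction h with
  | zero => simp
  | @succ n a b c h _ ih =>
    have hab : b.depth ≤ a.depth + L := by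
      obtain ⟨ρ, hρ, C, σ, rfl, rfl, -⟩ := h
      refine C.depth_fill_le ?_
      have h1 := Term.depth_subst_le (σ := σ) (D := (ρ.lhs.subst σ).depth) ρ.rhs
        fun x hx => Term.depth_le_depth_subst (ρ.vars_subset hx)
      have h2 := hL ρ hρ
      omega
    rw [Nat.mul_succ]
    omega

theorem Rule.exists_lhs_eq_app (ρ : Rule S V) :
    ∃ (f : S.Symb) (n : ℕ) (h : S.Admits f n) (ts : Fin n → Term S V),
      ρ.lhs = .app f n h ts := by
  cases hl : ρ.lhs with
  | var x => exact absurd hl (ρ.lhs_ne_var x)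
  | app f n h ts => exact ⟨f, n, h, ts, rfl⟩

/-- The left-hand side of a rule that matches `f(t₁, …, tₙ)` has the form `f(l₁, …, lₙ)`. -/
theorem Rule.lhs_of_subst_eq {ρ : Rule S V} {σ : V → Term S V} {f : S.Symb} {n : ℕ}
    {h : S.Admits f n} {ts : Fin n → Term S V} (he : ρ.lhs.subst σ = .app f n h ts) :
    ∃ ls : Fin n → Term S V, ρ.lhs = .app f n h ls ∧ ∀ i, (ls i).subst σ = ts i := by
  obtain ⟨f', n', h', ls, hl⟩ := ρ.exists_lhs_eq_app
  rw [hl, Term.subst] at he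
  injection he with hf hn hts
  subst hf hn
  exact ⟨ls, hl, fun i => congrFun (eq_of_heq hts) i⟩

theorem TRS.IsValue.of_fill {C : Context S V} {s : Term S V} (h : R.IsValue (C.fill s)) :
    R.IsValue s := by
  induction C with
  | hole => exact h
  | app f n k ts i C ih =>
    have := h.2 i
    rw [Function.update_self] at this
    exact ih this

theorem TRS.IsValue.isNormalForm {s : Term S V} (h : R.IsValue s) : R.IsNormalForm s := by
  rintro ⟨t, ρ, hρ, C, σ, rfl, -⟩
  obtain ⟨f, n, k, ts, hl⟩ := ρ.exists_lhs_eq_app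
  have h1 := h.of_fill
  rw [hl, Term.subst] at h1
  exact h1.1 ⟨ρ, hρ, n, k, ts, hl⟩

end Derivations

/-! ### The orders on values -/

section Orders

variable {R : TRS S V} {gt : S.Symb → S.Symb → Prop} {μ : SafeMapping R}

theorem SafeMapping.mem_normalArgs {f : S.Symb} {n : ℕ} {ts : Fin n → Term S V}
    {a : Term S V} : a ∈ μ.normalArgs f ts ↔ ∃ i : Fin n, (i : ℕ) ∉ μ.safe f ∧ ts i = a := by
  simp [SafeMapping.normalArgs]

theorem SafeMapping.mem_safeArgs {f : S.Symb} {n : ℕ} {ts : Fin n → Term S V}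
    {a : Term S V} : a ∈ μ.safeArgs f ts ↔ ∃ i : Fin n, (i : ℕ) ∈ μ.safe f ∧ ts i = a := by
  simp [SafeMapping.safeArgs]

theorem SafeMapping.normalArgs_map {f : S.Symb} {n : ℕ} (ts : Fin n → Term S V)
    (g : Term S V → Term S V) :
    μ.normalArgs f (fun i => g (ts i)) = (μ.normalArgs f ts).map g := by
  simp [SafeMapping.normalArgs, Multiset.map_map]

theorem SafeMapping.card_normalArgs_le {f : S.Symb} {n : ℕ} (ts : Fin n → Term S V) :
    (μ.normalArgs f ts).card ≤ n := by
  classical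
  simp only [SafeMapping.normalArgs, Multiset.card_map, Finset.card_val]
  exact (Finset.card_le_univ _).trans (by simp)

theorem GtSq.properSubterm {s t : Term S V} (h : GtSq R gt μ s t) (hs : R.IsValue s) :
    s.ProperSubterm t := by
  induction h with
  | arg_eq i _ => exact .arg i
  | arg_gt i _ _ ih => exact .deep i (ih (hs.2 i))
  | drop hf _ _ _ => exact absurd hf hs.1

theorem GtPop.properSubterm {s t : Term S V} (h : GtPop R gt μ s t) (hs : R.IsValue s) :
    s.ProperSubterm t := by
  induction h with
  | of_sq h => exact h.properSubterm hs
  | arg_eq i => exact .arg i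
  | arg_gt i _ ih => exact .deep i (ih (hs.2 i))
  | drop _ hf _ _ _ _ _ => exact absurd hf hs.1
  | @same f n m h k s t r _ hn _ _ =>
    -- A constructor has no normal arguments that could decrease.
    obtain ⟨X, Y, Z, hX, hM, -⟩ := hn
    have h0 : μ.normalArgs f s = 0 := by
      simp [SafeMapping.normalArgs, μ.safe_of_constructor f hs.1]
    rw [h0] at hM
    exact absurd (add_eq_zero.1 hM.symm).1 hX

end Orders

/-! ### Costs of function calls -/

section Costs

variable {R : TRS S V} {gt : S.Symb → S.Symb → Prop} {μ : SafeMapping R}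

/-- Innermost derivations from `f(u₁, …, uₙ)` with normal forms `uᵢ` have length at most
`p M`, where `M` bounds the depths of the normal arguments. -/
def CostBounded (R : TRS S V) (μ : SafeMapping R) (f : S.Symb) (p : Polynomial ℕ) : Prop :=
  ∀ (M n : ℕ) (h : S.Admits f n) (ts : Fin n → Term S V),
    (∀ i, R.IsNormalForm (ts i)) → (∀ a ∈ μ.normalArgs f ts, a.depth ≤ M) →
    ∀ N u, StepsIn R.InnermostStep N (.app f n h ts) u → N ≤ p.eval M

theorem CostBounded.of_isConstructor {f : S.Symb} (hf : R.IsConstructor f) :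
    CostBounded R μ f 0 := by
  intro M n h ts hts _ N u H
  rcases H.app_root hts with rfl | ⟨ρ, hρ, σ, N', he, -⟩
  · simp
  · obtain ⟨ls, hl, -⟩ := Rule.lhs_of_subst_eq he
    exact absurd ⟨ρ, hρ, n, h, ls, hl⟩ hf

/-- If `l ⊐ t`, then the lengths of the derivations from `tσ` and the depths of their results
are polynomial in the depths of the normal arguments of `lσ`. -/
theorem GtSq.exists_bound (hfin : R.Finite) {f : S.Symb} (hf : R.IsDefined f)
    (hprec : ∀ g, gt f g → ∃ p, CostBounded R μ g p) {n : ℕ} {h : S.Admits f n}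
    {ls : Fin n → Term S V} (hls : ∀ i, R.IsValue (ls i)) {l t : Term S V}
    (H : GtSq R gt μ l t) (hl : l = .app f n h ls) :
    ∃ q : Polynomial ℕ, ∀ (σ : V → Term S V) (M : ℕ),
      (∀ w, (l.subst σ).ProperSubterm w → R.IsNormalForm w) →
      (∀ a ∈ μ.normalArgs f (fun i => (ls i).subst σ), a.depth ≤ M) →
      ∀ N u, StepsIn R.InnermostStep N (t.subst σ) u → N ≤ q.eval M ∧ u.depth ≤ q.eval M := by
  obtain ⟨L, hL⟩ := exists_depth_le_of_steps hfin
  -- Subterms of normal arguments are instantiated to normal forms of depth at most `M`.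
  have hsub : ∀ (i : Fin n) (t : Term S V), (R.IsConstructor f ∨ (i : ℕ) ∉ μ.safe f) →
      (ls i = t ∨ (ls i).ProperSubterm t) → ∃ q : Polynomial ℕ, ∀ (σ : V → Term S V) (M : ℕ),
      (∀ w, ((Term.app f n h ls).subst σ).ProperSubterm w → R.IsNormalForm w) →
      (∀ a ∈ μ.normalArgs f (fun i => (ls i).subst σ), a.depth ≤ M) →
      ∀ N u, StepsIn R.InnermostStep N (t.subst σ) u →
        N ≤ q.eval M ∧ u.depth ≤ q.eval M := by
    intro i t hi ht
    refine ⟨Polynomial.X, fun σ M hnf hM N u HS => ?_⟩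
    have hP : (Term.app f n h ls).ProperSubterm t := by
      rcases ht with rfl | ht
      exacts [.arg i, .deep i ht]
    have hN := (hnf _ (hP.subst σ)).steps_eq_zero HS
    have hu := hL N _ _ HS
    have hle : (t.subst σ).depth ≤ ((ls i).subst σ).depth := by
      rcases ht with rfl | ht
      exacts [le_rfl, (ht.subst σ).depth_lt.le]
    have hd := hM ((ls i).subst σ)
      (SafeMapping.mem_normalArgs.2 ⟨i, hi.resolve_left fun hc => hc hf, rfl⟩)
    subst hN
    rw [Polynomial.eval_X]
    omega
  induction H with
  | arg_eq i hi =>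
    injection hl with h1 h2 h3
    subst h1 h2
    obtain rfl := eq_of_heq h3
    exact hsub i _ hi (.inl rfl)
  | arg_gt i hi hgt _ =>
    injection hl with h1 h2 h3
    subst h1 h2
    obtain rfl := eq_of_heq h3
    exact hsub i _ hi (.inr (hgt.properSubterm (hls i)))
  | @drop f' g _ m _ k s t _ hg _ ih =>
    have ih' := fun i => ih i hl
    injection hl with h1 h2 h3
    subst h1 h2
    obtain rfl := eq_of_heq h3
    choose q hq using ih'
    obtain ⟨p, hp⟩ := hprec g hg
    -- `Q` bounds the depths of the evaluated arguments, `Q + p.comp Q` the number of steps.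
    set Q : Polynomial ℕ := ∑ i, q i with hQ
    have hle : ∀ i M, (q i).eval M ≤ Q.eval M := fun i M => by
      rw [hQ, Polynomial.eval_finsetSum]
      exact Finset.single_le_sum (f := fun i => (q i).eval M) (fun _ _ => Nat.zero_le _)
        (Finset.mem_univ i)
    refine ⟨1 + Q + Polynomial.C (L + 1) * (Q + p.comp Q), fun σ M hnf hM N u HS => ?_⟩
    have hdepth : ((Term.app g m k t).subst σ).depth ≤ 1 + Q.eval M :=
      Term.depth_app_le k fun i => ((hq i σ M hnf hM 0 _ (.zero _)).2).trans (hle i M)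
    have hu := hL N _ _ HS
    have hN : N ≤ Q.eval M + p.eval (Q.eval M) := by
      rw [Term.subst] at HS
      obtain ⟨Ns, us, N', hs, rfl, hr⟩ := HS.app_decompose
      have hsum : ∑ i, Ns i ≤ Q.eval M := by
        rw [hQ, Polynomial.eval_finsetSum]
        exact Finset.sum_le_sum fun i _ => (hq i σ M hnf hM _ _ (hs i)).1
      rcases hr with rfl | ⟨hus, hr⟩
      · omega
      · refine Nat.add_le_add hsum (hp _ m k us hus (fun a ha => ?_) N' u hr)
        obtain ⟨i, -, rfl⟩ := SafeMapping.mem_normalArgs.1 ha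
        exact ((hq i σ M hnf hM _ _ (hs i)).2).trans (hle i M)
    simp only [Polynomial.eval_add, Polynomial.eval_mul, Polynomial.eval_C,
      Polynomial.eval_comp, Polynomial.eval_one]
    have h1 : L * N ≤ L * (Q.eval M + p.eval (Q.eval M)) := Nat.mul_le_mul_left L hN
    rw [Nat.add_mul]
    constructor <;> omega

/-- If `l >pop* t`, then the lengths of the derivations from `tσ` are polynomial in the depths
of the normal arguments of `lσ`, up to the cost `W` of a single recursive call. -/
theorem GtPop.exists_bound (hfin : R.Finite) {f : S.Symb} (hf : R.IsDefined f)
    (hprec : ∀ g, gt f g → ∃ p, CostBounded R μ g p) {n : ℕ} {h : S.Admits f n}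
    {ls : Fin n → Term S V} (hls : ∀ i, R.IsValue (ls i)) {l t : Term S V}
    (H : GtPop R gt μ l t) (hl : l = .app f n h ls) :
    ∃ q : Polynomial ℕ, ∀ (σ : V → Term S V) (M W : ℕ),
      (∀ w, (l.subst σ).ProperSubterm w → R.IsNormalForm w) →
      (∀ a ∈ μ.normalArgs f (fun i => (ls i).subst σ), a.depth ≤ M) →
      (∀ (m : ℕ) (k : S.Admits f m) (ts : Fin m → Term S V), (∀ i, R.IsNormalForm (ts i)) →
        ((μ.normalArgs f ts).map Term.depth).IsDershowitzMannaLT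
          ((μ.normalArgs f fun i => (ls i).subst σ).map Term.depth) →
        ∀ N u, StepsIn R.InnermostStep N (.app f m k ts) u → N ≤ W) →
      ∀ N u, StepsIn R.InnermostStep N (t.subst σ) u → N ≤ q.eval M + W := by
  have hsub : ∀ t, (Term.app f n h ls).ProperSubterm t →
      ∃ q : Polynomial ℕ, ∀ (σ : V → Term S V) (M W : ℕ),
      (∀ w, ((Term.app f n h ls).subst σ).ProperSubterm w → R.IsNormalForm w) →
      ∀ N u, StepsIn R.InnermostStep N (t.subst σ) u → N ≤ q.eval M + W := by
    refine fun t ht => ⟨0, fun σ M W hnf N u HS => ?_⟩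
    rw [(hnf _ (ht.subst σ)).steps_eq_zero HS]
    exact Nat.zero_le _
  induction H with
  | of_sq hsq =>
    obtain ⟨q, hq⟩ := hsq.exists_bound hfin hf hprec hls hl
    exact ⟨q, fun σ M W hnf hM _ N u HS => (hq σ M hnf hM N u HS).1.trans (Nat.le_add_right _ _)⟩
  | arg_eq i =>
    injection hl with h1 h2 h3
    subst h1 h2
    obtain rfl := eq_of_heq h3
    obtain ⟨q, hq⟩ := hsub _ (.arg i)
    exact ⟨q, fun σ M W hnf _ _ => hq σ M W hnf⟩
  | arg_gt i hgt _ =>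
    injection hl with h1 h2 h3
    subst h1 h2
    obtain rfl := eq_of_heq h3
    obtain ⟨q, hq⟩ := hsub _ (.deep i (hgt.properSubterm (hls i)))
    exact ⟨q, fun σ M W hnf _ _ => hq σ M W hnf⟩
  | @drop f' g _ m _ k s t i₀ _ hg hi₀ _ hothers ih =>
    have ih' := ih hl
    injection hl with h1 h2 h3
    subst h1 h2
    obtain rfl := eq_of_heq h3
    obtain ⟨p, hp⟩ := hprec g hg
    -- Only the safe argument `i₀` may contain the recursive call; the arguments in
    -- normal positions of `g` have small depth after their evaluation.
    have hargs : ∀ i, ∃ q : Polynomial ℕ, ∀ (σ : V → Term S V) (M W : ℕ),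
        (∀ w, ((Term.app f' _ h s).subst σ).ProperSubterm w → R.IsNormalForm w) →
        (∀ a ∈ μ.normalArgs f' (fun i => (s i).subst σ), a.depth ≤ M) →
        (∀ (m : ℕ) (k : S.Admits f' m) (ts : Fin m → Term S V),
          (∀ i, R.IsNormalForm (ts i)) →
          ((μ.normalArgs f' ts).map Term.depth).IsDershowitzMannaLT
            ((μ.normalArgs f' fun i => (s i).subst σ).map Term.depth) →
          ∀ N u, StepsIn R.InnermostStep N (.app f' m k ts) u → N ≤ W) →
        ∀ N u, StepsIn R.InnermostStep N ((t i).subst σ) u →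
          N ≤ q.eval M + (if i = i₀ then W else 0) ∧
          ((i : ℕ) ∉ μ.safe g → u.depth ≤ q.eval M) := by
      intro i
      by_cases hi : i = i₀
      · subst hi
        obtain ⟨q, hq⟩ := ih'
        exact ⟨q, fun σ M W hnf hM hW N u HS =>
          ⟨by simpa using hq σ M W hnf hM hW N u HS, fun hn => absurd hi₀ hn⟩⟩
      · rcases hothers i hi with hsq | ⟨hP, hsafe⟩
        · obtain ⟨q, hq⟩ := hsq.exists_bound hfin hf hprec hls rfl
          exact ⟨q, fun σ M W hnf hM _ N u HS => by
            simpa [hi] using ⟨(hq σ M hnf hM N u HS).1, fun _ => (hq σ M hnf hM N u HS).2⟩⟩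
        · exact ⟨0, fun σ M W hnf _ _ N u HS =>
            ⟨by simp [(hnf _ (hP.subst σ)).steps_eq_zero HS], fun hn => absurd hsafe hn⟩⟩
    choose q hq using hargs
    set Q : Polynomial ℕ := ∑ i, q i with hQ
    refine ⟨Q + p.comp Q, fun σ M W hnf hM hW N u HS => ?_⟩
    rw [Term.subst] at HS
    obtain ⟨Ns, us, N', hs, rfl, hr⟩ := HS.app_decompose
    have hsum : ∑ i, Ns i ≤ Q.eval M + W := by
      have := Finset.sum_le_sum fun i (_ : i ∈ Finset.univ) =>
        (hq i σ M W hnf hM hW _ _ (hs i)).1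
      rw [Finset.sum_add_distrib] at this
      simpa [hQ, Polynomial.eval_finsetSum] using this
    have hN' : N' ≤ p.eval (Q.eval M) := by
      rcases hr with rfl | ⟨hus, hr⟩
      · exact Nat.zero_le _
      · refine hp _ m k us hus (fun a ha => ?_) N' u hr
        obtain ⟨i, hi, rfl⟩ := SafeMapping.mem_normalArgs.1 ha
        refine ((hq i σ M W hnf hM hW _ _ (hs i)).2 hi).trans ?_
        rw [hQ, Polynomial.eval_finsetSum]
        exact Finset.single_le_sum (f := fun i => (q i).eval M) (fun _ _ => Nat.zero_le _)
          (Finset.mem_univ i)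
    rw [Polynomial.eval_add, Polynomial.eval_comp]
    omega
  | @same f' _ m _ k s t r hr hn hs _ =>
    injection hl with h1 h2 h3
    subst h1 h2
    obtain rfl := eq_of_heq h3
    -- All arguments of the recursive call are proper subterms of `l`.
    have hbelow : ∀ a b, (∃ i, s i = a) → r a b → a.ProperSubterm b := by
      rintro _ b ⟨i, rfl⟩ hab
      exact (hr _ _ hab).properSubterm (hls i)
    have hprop : ∀ a b, (∃ i, s i = a) → (a = b ∨ r a b) →
        (Term.app f' _ h s).ProperSubterm b := by
      rintro _ b ⟨i, rfl⟩ (rfl | hab)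
      exacts [.arg i, .deep i (hbelow _ _ ⟨i, rfl⟩ hab)]
    have hmul : ∀ {M N : Multiset (Term S V)} {b : Term S V}, MulGe r M N → b ∈ N →
        ∃ a ∈ M, a = b ∨ r a b := by
      rintro M N b (rfl | ⟨X, Y, Z, -, rfl, rfl, hY⟩) hb
      · exact ⟨b, hb, .inl rfl⟩
      · rcases Multiset.mem_add.1 hb with hb | hb
        · obtain ⟨x, hx, hxb⟩ := hY b hb
          exact ⟨x, Multiset.mem_add.2 (.inl hx), .inr hxb⟩
        · exact ⟨b, Multiset.mem_add.2 (.inr hb), .inl rfl⟩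
    have hts : ∀ j, (Term.app f' _ h s).ProperSubterm (t j) := by
      intro j
      by_cases hj : (j : ℕ) ∈ μ.safe f'
      · obtain ⟨a, ha, hab⟩ := hmul hs (SafeMapping.mem_safeArgs.2 ⟨j, hj, rfl⟩)
        obtain ⟨i, -, hi⟩ := SafeMapping.mem_safeArgs.1 ha
        exact hprop a _ ⟨i, hi⟩ hab
      · obtain ⟨a, ha, hab⟩ := hmul (.inr hn) (SafeMapping.mem_normalArgs.2 ⟨j, hj, rfl⟩)
        obtain ⟨i, -, hi⟩ := SafeMapping.mem_normalArgs.1 ha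
        exact hprop a _ ⟨i, hi⟩ hab
    refine ⟨0, fun σ M W hnf hM hW N u HS => ?_⟩
    rw [Polynomial.eval_zero, Nat.zero_add]
    refine hW m k (fun j => (t j).subst σ) (fun j => hnf _ ((hts j).subst σ)) ?_ N u HS
    obtain ⟨X, Y, Z, hX, hM', hN', hY⟩ := hn
    refine ⟨Z.map fun a => (a.subst σ).depth, Y.map fun a => (a.subst σ).depth,
      X.map fun a => (a.subst σ).depth, by simpa using hX, ?_, ?_, ?_⟩
    · rw [SafeMapping.normalArgs_map t (Term.subst σ), hN', Multiset.map_map, add_comm,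
        Multiset.map_add]
      rfl
    · rw [SafeMapping.normalArgs_map s (Term.subst σ), hM', Multiset.map_map, add_comm,
        Multiset.map_add]
      rfl
    · intro y hy
      obtain ⟨b, hb, rfl⟩ := Multiset.mem_map.1 hy
      obtain ⟨a, ha, hab⟩ := hY b hb
      refine ⟨_, Multiset.mem_map_of_mem _ ha, ?_⟩
      have hmem : a ∈ μ.normalArgs f' s := hM' ▸ Multiset.mem_add.2 (.inl ha)
      obtain ⟨i, -, hi⟩ := SafeMapping.mem_normalArgs.1 hmem
      exact ((hbelow a b ⟨i, hi⟩ hab).subst σ).depth_lt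

theorem le_of_isDershowitzMannaLT {A B : Multiset ℕ} {M : ℕ} (h : B.IsDershowitzMannaLT A)
    (hA : ∀ a ∈ A, a ≤ M) : ∀ b ∈ B, b ≤ M := by
  obtain ⟨X, Y, Z, -, rfl, rfl, hYZ⟩ := h
  intro b hb
  rcases Multiset.mem_add.1 hb with hb | hb
  · exact hA b (Multiset.mem_add.2 (.inl hb))
  · obtain ⟨z, hz, hbz⟩ := hYZ b hb
    exact hbz.le.trans (hA z (Multiset.mem_add.2 (.inr hz)))

/-- The induction step along the precedence. The recursion of `f` itself is handled by
induction on the rank of the multiset of the depths of its normal arguments. -/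
theorem exists_costBounded_of_prec (hfin : R.Finite) (hcons : R.IsConstructorTRS)
    (hcomp : IsCompatiblePop R gt μ) {f : S.Symb} (hf : R.IsDefined f)
    (hprec : ∀ g, gt f g → ∃ p, CostBounded R μ g p) : ∃ p, CostBounded R μ f p := by
  -- A uniform bound for the right-hand sides of the rules that define `f`.
  obtain ⟨q, hq⟩ := exists_uniform_polynomial hfin
    (P := fun ρ q => ∀ (n : ℕ) (h : S.Admits f n) (ls : Fin n → Term S V),
      ρ.lhs = .app f n h ls → ∀ (σ : V → Term S V) (M W : ℕ),
      (∀ w, (ρ.lhs.subst σ).ProperSubterm w → R.IsNormalForm w) →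
      (∀ a ∈ μ.normalArgs f (fun i => (ls i).subst σ), a.depth ≤ M) →
      (∀ (m : ℕ) (k : S.Admits f m) (ts : Fin m → Term S V), (∀ i, R.IsNormalForm (ts i)) →
        ((μ.normalArgs f ts).map Term.depth).IsDershowitzMannaLT
          ((μ.normalArgs f fun i => (ls i).subst σ).map Term.depth) →
        ∀ N u, StepsIn R.InnermostStep N (.app f m k ts) u → N ≤ W) →
      ∀ N u, StepsIn R.InnermostStep N (ρ.rhs.subst σ) u → N ≤ q.eval M + W)
    (fun ρ p q hpq h n k ls hl σ M W h1 h2 h3 N u HS =>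
      (h n k ls hl σ M W h1 h2 h3 N u HS).trans (Nat.add_le_add_right (hpq M) W))
    (fun ρ hρ => by
      obtain ⟨f', n, h, ls, hl⟩ := ρ.exists_lhs_eq_app
      by_cases hff : f' = f
      · subst hff
        obtain ⟨q, hq⟩ := (hcomp ρ hρ).exists_bound hfin hf hprec
          (hcons ρ hρ f' n h ls hl) hl
        refine ⟨q, fun n' h' ls' hl' => ?_⟩
        rw [hl] at hl'
        injection hl' with _ h2 h3
        subst h2
        obtain rfl := eq_of_heq h3
        exact hq
      · refine ⟨0, fun n' h' ls' hl' => ?_⟩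
        rw [hl] at hl'
        injection hl' with h1
        exact absurd h1 hff)
  obtain ⟨K, hK⟩ : ∃ K, ∀ ρ ∈ R, ∀ (n : ℕ) (h : S.Admits f n) (ls : Fin n → Term S V),
      ρ.lhs = .app f n h ls → n ≤ K := by
    obtain ⟨K, hK⟩ := exists_uniform_nat hfin fun ρ => match ρ.lhs with
      | .var _ => 0
      | .app _ n _ _ => n
    refine ⟨K, fun ρ hρ n h ls hl => ?_⟩
    have := hK ρ hρ
    rw [hl] at this
    exact this
  refine ⟨((Polynomial.X + 2) ^ K + 1) * (1 + q), fun M n h ts hts hM N u HS => ?_⟩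
  obtain ⟨rk, hrk, hlt⟩ := exists_rank M K
  have key : ∀ (r n : ℕ) (h : S.Admits f n) (ts : Fin n → Term S V),
      rk ((μ.normalArgs f ts).map Term.depth) ≤ r →
      (∀ i, R.IsNormalForm (ts i)) → (∀ a ∈ μ.normalArgs f ts, a.depth ≤ M) →
      ∀ N u, StepsIn R.InnermostStep N (.app f n h ts) u →
        N ≤ (r + 1) * (1 + q.eval M) := by
    intro r
    induction r using Nat.strong_induction_on with
    | _ r ih =>
      intro n h ts hr hts hM N u HS
      rcases HS.app_root hts with rfl | ⟨ρ, hρ, σ, N, he, hnf, rfl, HS'⟩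
      · exact Nat.zero_le _
      · obtain ⟨ls, hl, hσ⟩ := Rule.lhs_of_subst_eq he
        obtain rfl : (fun i => (ls i).subst σ) = ts := funext hσ
        have := hq ρ hρ n h ls hl σ M (r * (1 + q.eval M)) hnf hM ?_ N u HS'
        · rw [Nat.add_mul]
          omega
        intro m k ts' hts' hDM N' u' HS''
        -- A recursive call with more than `K` arguments matches no left-hand side.
        by_cases hmK : m ≤ K
        · have hM' : ∀ b ∈ (μ.normalArgs f ts').map Term.depth, b ≤ M :=
            le_of_isDershowitzMannaLT hDM fun a ha => by
              obtain ⟨t, ht, rfl⟩ := Multiset.mem_map.1 ha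
              exact hM t ht
          have hlt' := hlt _ _ (by
            rw [Multiset.card_map]
            exact (SafeMapping.card_normalArgs_le ts').trans hmK) hM' hDM
          have := ih _ (hlt'.trans_le hr) m k ts' le_rfl hts'
            (fun a ha => hM' _ (Multiset.mem_map_of_mem _ ha)) N' u' HS''
          exact this.trans (Nat.mul_le_mul_right _ (by omega))
        · rcases HS''.app_root hts' with rfl | ⟨ρ', hρ', σ', _, he', -⟩
          · exact Nat.zero_le _
          · obtain ⟨ls', hl', -⟩ := Rule.lhs_of_subst_eq he'
            exact absurd (hK ρ' hρ' m k ls' hl') hmK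
  have := key _ n h ts (hrk _) hts hM N u HS
  simpa using this

theorem finite_isDefined (hfin : R.Finite) : {f | R.IsDefined f}.Finite := by
  choose rt hrt using fun ρ : Rule S V => ρ.exists_lhs_eq_app
  refine (hfin.image rt).subset ?_
  rintro f ⟨ρ, hρ, n, h, ts, hl⟩
  obtain ⟨n', h', ts', hl'⟩ := hrt ρ
  rw [hl] at hl'
  injection hl' with h1
  exact ⟨ρ, hρ, h1.symm⟩

theorem exists_costBounded (hfin : R.Finite) (hcons : R.IsConstructorTRS)
    (hgt : IsStrictOrder S.Symb gt) (hcomp : IsCompatiblePop R gt μ) (f : S.Symb) :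
    ∃ p, CostBounded R μ f p := by
  by_cases hf : R.IsDefined f
  · have : Finite {f // R.IsDefined f} := (finite_isDefined hfin).to_subtype
    let r : {f // R.IsDefined f} → {f // R.IsDefined f} → Prop := fun a b => gt b.1 a.1
    have : IsTrans _ r := ⟨fun a b c hab hbc => hgt.trans _ _ _ hbc hab⟩
    have : Std.Irrefl r := ⟨fun a => hgt.irrefl a.1⟩
    have hwf : WellFounded r := Finite.wellFounded_of_trans_of_irrefl r
    have key : ∀ a : {f // R.IsDefined f}, ∃ p, CostBounded R μ a.1 p := fun a => by
      induction a using hwf.induction with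
      | _ a ih =>
        refine exists_costBounded_of_prec hfin hcons hcomp a.2 fun g hg => ?_
        by_cases hgd : R.IsDefined g
        · exact ih ⟨g, hgd⟩ hg
        · exact ⟨0, .of_isConstructor hgd⟩
    exact key ⟨f, hf⟩
  · exact ⟨0, .of_isConstructor hf⟩

theorem exists_uniform_costBounded (hfin : R.Finite) (hcons : R.IsConstructorTRS)
    (hgt : IsStrictOrder S.Symb gt) (hcomp : IsCompatiblePop R gt μ) :
    ∃ p, ∀ f, CostBounded R μ f p := by
  have hmono : ∀ (f : S.Symb) (p q : Polynomial ℕ), (∀ m : ℕ, p.eval m ≤ q.eval m) →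
      CostBounded R μ f p → CostBounded R μ f q :=
    fun f p q hpq hp M n h ts h1 h2 N u HS => (hp M n h ts h1 h2 N u HS).trans (hpq M)
  obtain ⟨p, hp⟩ := exists_uniform_polynomial (finite_isDefined hfin) hmono
    fun f _ => exists_costBounded hfin hcons hgt hcomp f
  refine ⟨p, fun f => ?_⟩
  by_cases hf : R.IsDefined f
  · exact hp f hf
  · exact hmono f 0 p (by simp) (.of_isConstructor hf)

theorem normalArgs_size_sum_le {f : S.Symb} {n : ℕ} (h : S.Admits f n)
    (ts : Fin n → Term S V) :
    ((μ.normalArgs f ts).map Term.size).sum ≤ (Term.app f n h ts).size := by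
  classical
  simp only [SafeMapping.normalArgs, Multiset.map_map, Term.size]
  refine le_trans ?_ (Nat.le_add_left _ _)
  exact Finset.sum_le_sum_of_subset (f := fun i => (ts i).size) (Finset.filter_subset _ _)

end Costs

end POPStar

theorem mainTheorem2 {S : POPStar.Signature} {V : Type*} (R : POPStar.TRS S V)
    (hfin : R.Finite) (hcons : R.IsConstructorTRS)
    (gt : S.Symb → S.Symb → Prop) (hgt : IsStrictOrder S.Symb gt)
    (μ : POPStar.SafeMapping R) (hcomp : POPStar.IsCompatiblePop R gt μ) :
    POPStar.PolynomiallyBounded (POPStar.normalRuntimeComplexity R μ) ∧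
      POPStar.PolynomiallyBounded (POPStar.runtimeComplexity R) := by
  obtain ⟨p, hp⟩ := POPStar.exists_uniform_costBounded hfin hcons hgt hcomp
  have key : ∀ (m : ℕ) (f : S.Symb) (n : ℕ) (h : S.Admits f n)
      (ts : Fin n → POPStar.Term S V), (∀ i, R.IsValue (ts i)) →
      ((μ.normalArgs f ts).map POPStar.Term.size).sum ≤ m →
      POPStar.derivationLength R.InnermostStep (.app f n h ts) ≤ ((p.eval m : ℕ) : ℕ∞) := by
    intro m f n h ts hts hm
    refine iSup₂_le fun N ⟨u, HS⟩ => ?_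
    refine Nat.cast_le.2 (hp f m n h ts (fun i => (hts i).isNormalForm) (fun a ha => ?_) N u HS)
    exact a.depth_le_size.trans
      ((Multiset.single_le_sum (fun _ _ => Nat.zero_le _) _
        (Multiset.mem_map_of_mem _ ha)).trans hm)
  refine ⟨⟨p, fun m => ?_⟩, ⟨p, fun m => ?_⟩⟩
  · exact iSup_le fun f => iSup_le fun n => iSup_le fun h => iSup_le fun ts =>
      iSup₂_le fun hts hm => key m f n h ts hts hm
  · exact iSup_le fun f => iSup_le fun n => iSup_le fun h => iSup_le fun ts =>
      iSup₂_le fun hts hm =>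
        key m f n h ts hts ((POPStar.normalArgs_size_sum_le h ts).trans hm)
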